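/- Let $\mathbb{F}_q$ be a finite field, $\mathcal{K}=\mathbb{F}_q((t))$, $\mathcal{O}=\mathbb{F}_q[[t]]$ and $G=PGL_2(\mathcal{K})$ with its usual (quotient) topology. Let $I^0\subset G$ be the subgroup of classes of matrices $\begin{pmatrix}1+ta&b\\tc&1+td\end{pmatrix}$ with $a,b,c,d\in\mathcal{O}$, let $\sigma\in G$ be the class of $\begin{pmatrix}0&1\\t&0\end{pmatrix}$, and let $A\subset G$ be the subgroup generated by $I^0$ and $\sigma$. Let $\psi:\mathbb{F}_q\to\mathbb{C}^\times$ be a nontrivial character of the additive group, and let $\chi:A\to\mathbb{C}^\times$ be the unique character with $\chi\begin{pmatrix}1+ta&b\\tc&1+td\end{pmatrix}=\psi(b_0+c_0)$ on $I^0$ and $\chi(\sigma)=1$, where $x_0$ denotes the constant term of $x\in\mathcal{O}$. Let $V=\mathrm{ind}_A^G\chi$ be the space of compactly supported functions $f:G\to\mathbb{C}$ that are invariant under right translation by some open subgroup and satisfy $f(ga)=\chi(a)f(g)$ for all $g\in G$, $a\in A$, with $G$ acting by $(h\cdot f)(g)=f(h^{-1}g)$. Then $V$ is an irreducible cuspidal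 representation of $G$. That is: $V\neq 0$ and $V$ has no $G$-stable subspaces other than $0$ and $V$; $V$ is admissible, i.e. smooth (every vector is fixed by an open subgroup) with the space of $H$-fixed vectors finite-dimensional for every open subgroup $H\subset G$; and every linear functional on $V$ that is invariant under $U(\mathcal{K})=\left\{\begin{pmatrix}1&u\\0&1\end{pmatrix}:u\in\mathcal{K}\right\}$ is zero. -/

import Mathlib

open scoped MatrixGroups PowerSeries LaurentSeries
open Matrix

/-! ### Smooth representations of topological groups -/

section Smooth

variable {G : Type*} [Group G] [TopologicalSpace G]
variable {V : Type*} [AddCommGroup V] [Module ℂ V]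

/-- A complex representation is smooth if every vector is fixed by some open subgroup. -/
def IsSmoothRep (ρ : Representation ℂ G V) : Prop :=
  ∀ v : V, ∃ U : Subgroup G, IsOpen (U : Set G) ∧ ∀ u ∈ U, ρ u v = v

/-- The space of vectors fixed by a subgroup `U`. -/
def fixedVectors (ρ : Representation ℂ G V) (U : Subgroup G) : Submodule ℂ V where
  carrier := {v | ∀ u ∈ U, ρ u v = v}
  add_mem' := by
    intro v w hv hw u hu
    rw [map_add, hv u hu, hw u hu]
  zero_mem' := by
    intro u _
    exact map_zero _
  smul_mem' := by
    intro c v hv u hu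
    rw [map_smul, hv u hu]

/-- A representation is admissible if it is smooth and the fixed vectors of every open subgroup
form a finite-dimensional space. -/
structure IsAdmissibleRep (ρ : Representation ℂ G V) : Prop where
  smooth : IsSmoothRep ρ
  finite_fixed : ∀ U : Subgroup G, IsOpen (U : Set G) → FiniteDimensional ℂ (fixedVectors ρ U)

/-- `C^∞(G)`: the functions `f : G → ℂ` that are invariant under right translation by some
open subgroup and are supported in a compact set. -/
def smoothCompactlySupported (G : Type*) [Group G] [TopologicalSpace G] :
    Submodule ℂ (G → ℂ) where
  carrier := {f | (∃ U : Subgroup G, IsOpen (U : Set G) ∧ ∀ g, ∀ u ∈ U, f (g * u) = f g) ∧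
    ∃ C : Set G, IsCompact C ∧ Function.support f ⊆ C}
  add_mem' := by
    rintro f g ⟨⟨U, hU, hf⟩, C, hC, hfC⟩ ⟨⟨U', hU', hg⟩, C', hC', hgC⟩
    refine ⟨⟨U ⊓ U', hU.inter hU', fun x u hu => ?_⟩, C ∪ C', hC.union hC', ?_⟩
    · rw [Pi.add_apply, Pi.add_apply, hf x u hu.1, hg x u hu.2]
    · exact (Function.support_add f g).trans (Set.union_subset_union hfC hgC)
  zero_mem' := ⟨⟨⊤, isOpen_univ, fun _ _ _ => rfl⟩, ∅, isCompact_empty, by simp⟩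
  smul_mem' := by
    rintro c f ⟨⟨U, hU, hf⟩, C, hC, hfC⟩
    refine ⟨⟨U, hU, fun x u hu => ?_⟩, C, hC, (Function.support_const_smul_subset c f).trans hfC⟩
    rw [Pi.smul_apply, Pi.smul_apply, hf x u hu]

/-- The space of compact induction from a character `χ` of a compact subgroup `A`: the functions
`f ∈ C^∞(G)` with `f (g a) = χ(a) f(g)` for `a ∈ A`. -/
def compactIndSpace (A : Subgroup G) (χ : A →* ℂ) : Submodule ℂ (G → ℂ) :=
  smoothCompactlySupported G ⊓
    { carrier := {f | ∀ (g : G) (a : A), f (g * a) = χ a * f g}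
      add_mem' := by
        intro f f' hf hf' g a
        rw [Pi.add_apply, Pi.add_apply, hf, hf', mul_add]
      zero_mem' := by
        intro g a
        simp
      smul_mem' := by
        intro c f hf g a
        rw [Pi.smul_apply, Pi.smul_apply, hf, smul_eq_mul, smul_eq_mul, mul_left_comm] }

theorem compactIndSpace_translate [IsTopologicalGroup G] {A : Subgroup G} {χ : A →* ℂ}
    (h : G) {f : G → ℂ} (hf : f ∈ compactIndSpace A χ) :
    (fun g => f (h⁻¹ * g)) ∈ compactIndSpace A χ := by
  obtain ⟨⟨⟨U, hU, hfU⟩, C, hC, hfC⟩, hχ⟩ := hf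
  refine ⟨⟨⟨U, hU, fun g u hu => ?_⟩, (fun g => h * g) '' C,
    hC.image (continuous_const_mul h), fun g hg => ?_⟩, fun g a => ?_⟩
  · simpa [mul_assoc] using hfU (h⁻¹ * g) u hu
  · exact ⟨h⁻¹ * g, hfC hg, by simp⟩
  · simpa [mul_assoc] using hχ (h⁻¹ * g) a

/-- The action of `G` on the compactly induced space by left translations,
`(h • f)(g) = f (h⁻¹ g)`. -/
def compactInd [IsTopologicalGroup G] (A : Subgroup G) (χ : A →* ℂ) :
    Representation ℂ G (compactIndSpace A χ) where
  toFun h :=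
    { toFun := fun f => ⟨fun g => f.1 (h⁻¹ * g), compactIndSpace_translate h f.2⟩
      map_add' := fun _ _ => rfl
      map_smul' := fun _ _ => rfl }
  map_one' := by
    ext f g
    simp
  map_mul' h h' := by
    ext f g
    simp [mul_assoc]

end Smooth

/-! ### The group `PGL₂(F((t)))` -/

/-- The topology of `PGL` is the quotient of the topology of `GL`. -/
instance pglTopologicalSpace {n : Type*} [Fintype n] [DecidableEq n] {R : Type*} [CommRing R]
    [TopologicalSpace R] : TopologicalSpace (ProjGenLinGroup n R) :=
  inferInstanceAs (TopologicalSpace (GL n R ⧸ Subgroup.center (GL n R)))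

instance pglIsTopologicalGroup {n : Type*} [Fintype n] [DecidableEq n] {R : Type*} [CommRing R]
    [TopologicalSpace R] [IsTopologicalRing R] : IsTopologicalGroup (ProjGenLinGroup n R) :=
  inferInstanceAs (IsTopologicalGroup (GL n R ⧸ Subgroup.center (GL n R)))

section Group

/-- The group of upper triangular unipotent matrices in `GL₂(R)`. -/
def unipotentGL (R : Type*) [CommRing R] : Subgroup (GL (Fin 2) R) where
  carrier := {M | ∃ u : R, M.1 = !![1, u; 0, 1]}
  mul_mem' := by
    rintro M N ⟨u, hM⟩ ⟨v, hN⟩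
    exact ⟨v + u, by simp [hM, hN]⟩
  one_mem' := ⟨0, by simp [Matrix.one_fin_two]⟩
  inv_mem' := by
    rintro M ⟨u, hM⟩
    refine ⟨-u, ?_⟩
    rw [Matrix.coe_units_inv, hM]
    simp [Matrix.inv_def, Matrix.adjugate_fin_two]

/-- The image `U(K)` of the upper triangular unipotent group in `PGL₂(K)`. -/
def unipotentPGL (K : Type*) [Field K] : Subgroup PGL(2, K) :=
  (unipotentGL K).map ProjGenLinGroup.mk

/-- A representation of `PGL₂(K)` is quasi-cuspidal if every `U(K)`-invariant linear functional on
it vanishes. -/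
def IsQuasiCuspidal {K : Type*} [Field K] {V : Type*} [AddCommGroup V] [Module ℂ V]
    (ρ : Representation ℂ PGL(2, K) V) : Prop :=
  ∀ l : V →ₗ[ℂ] ℂ, (∀ u ∈ unipotentPGL K, ∀ v : V, l (ρ u v) = l v) → l = 0

/-- A representation of `PGL₂(K)` is cuspidal if it is admissible and quasi-cuspidal. -/
structure IsCuspidalRep {K : Type*} [Field K] [TopologicalSpace K] {V : Type*} [AddCommGroup V]
    [Module ℂ V] (ρ : Representation ℂ PGL(2, K) V) : Prop where
  admissible : IsAdmissibleRep ρ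
  quasiCuspidal : IsQuasiCuspidal ρ

variable (F : Type*) [Field F]

/-- The map `GL₂(F[[t]]) → PGL₂(F((t)))`. -/
noncomputable def integralToPGL : GL (Fin 2) F⟦X⟧ →* PGL(2, F⸨X⸩) :=
  ProjGenLinGroup.mk.comp (GeneralLinearGroup.map (algebraMap F⟦X⟧ F⸨X⸩))

/-- The matrices in `GL₂(F[[t]])` whose value at `t = 0` is upper triangular unipotent. -/
noncomputable def iwahoriZeroGL : Subgroup (GL (Fin 2) F⟦X⟧) :=
  (unipotentGL F).comap (GeneralLinearGroup.map PowerSeries.constantCoeff)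

variable {F}

theorem mem_iwahoriZeroGL_iff (M : GL (Fin 2) F⟦X⟧) :
    M ∈ iwahoriZeroGL F ↔ PowerSeries.constantCoeff (M.1 0 0) = 1 ∧
      PowerSeries.constantCoeff (M.1 1 0) = 0 ∧ PowerSeries.constantCoeff (M.1 1 1) = 1 := by
  constructor
  · rintro ⟨u, hu⟩
    have h := fun i j => congrFun (congrFun hu i) j
    exact ⟨by simpa using h 0 0, by simpa using h 1 0, by simpa using h 1 1⟩
  · rintro ⟨h1, h2, h3⟩
    refine ⟨PowerSeries.constantCoeff (M.1 0 1), ?_⟩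
    ext i j
    fin_cases i <;> fin_cases j <;> simp [h1, h2, h3]

theorem mem_iwahoriZeroGL_iff_exists (M : GL (Fin 2) F⟦X⟧) :
    M ∈ iwahoriZeroGL F ↔ ∃ a b c d : F⟦X⟧,
      M.1 = !![1 + PowerSeries.X * a, b; PowerSeries.X * c, 1 + PowerSeries.X * d] := by
  rw [mem_iwahoriZeroGL_iff]
  constructor
  · rintro ⟨h1, h2, h3⟩
    obtain ⟨a, ha⟩ := PowerSeries.X_dvd_iff.2 (show PowerSeries.constantCoeff (M.1 0 0 - 1) = 0 by
      simp [h1])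
    obtain ⟨c, hc⟩ := PowerSeries.X_dvd_iff.2 h2
    obtain ⟨d, hd⟩ := PowerSeries.X_dvd_iff.2 (show PowerSeries.constantCoeff (M.1 1 1 - 1) = 0 by
      simp [h3])
    refine ⟨a, M.1 0 1, c, d, ?_⟩
    rw [← ha, ← hc, ← hd]
    ext i j : 2
    fin_cases i <;> fin_cases j <;> simp
  · rintro ⟨a, b, c, d, h⟩
    simp [h]

variable (F)

/-- The subgroup `I⁰` of `PGL₂(F((t)))`, the unipotent radical of the Iwahori subgroup. -/
noncomputable def iwahoriZero : Subgroup PGL(2, F⸨X⸩) :=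
  (iwahoriZeroGL F).map (integralToPGL F)

/-- The uniformizer `t` of `F((t))`. -/
noncomputable def unif : F⸨X⸩ := algebraMap F⟦X⟧ F⸨X⸩ PowerSeries.X

theorem unif_ne_zero : unif F ≠ 0 := by
  simp [unif]

/-- The matrix `(0, 1; t, 0)`. -/
noncomputable def sigmaGL : GL (Fin 2) F⸨X⸩ :=
  GeneralLinearGroup.mkOfDetNeZero !![0, 1; unif F, 0] (by simp [unif_ne_zero])

/-- The class `σ` of `(0, 1; t, 0)` in `PGL₂(F((t)))`. -/
noncomputable def sigma : PGL(2, F⸨X⸩) := ProjGenLinGroup.mk (sigmaGL F)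

/-- The subgroup `A` of `PGL₂(F((t)))` generated by `I⁰` and `σ`. -/
noncomputable def inducingGroup : Subgroup PGL(2, F⸨X⸩) :=
  iwahoriZero F ⊔ Subgroup.zpowers (sigma F)

variable {F}

theorem integralToPGL_mem {M : GL (Fin 2) F⟦X⟧} (hM : M ∈ iwahoriZeroGL F) :
    integralToPGL F M ∈ inducingGroup F :=
  Subgroup.mem_sup_left (Subgroup.mem_map_of_mem _ hM)

variable (F) in
theorem sigma_mem : sigma F ∈ inducingGroup F :=
  Subgroup.mem_sup_right (Subgroup.mem_zpowers _)

variable (F) in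
theorem sigma_mul_self : sigma F * sigma F = 1 := by
  rw [sigma, ← map_mul, ← ProjGenLinGroup.mk_one, eq_comm, ProjGenLinGroup.mk_eq_mk_iff]
  refine ⟨Units.mk0 _ (unif_ne_zero F), ?_⟩
  ext i j
  fin_cases i <;> fin_cases j <;> simp [sigmaGL, Matrix.mul_apply]

/-- The character `(1 + ta, b; tc, 1 + td) ↦ ψ(b₀ + c₀)` of the group of matrices
representing `I⁰`. -/
noncomputable def affineGenericGL (ψ : AddChar F ℂ) : iwahoriZeroGL F →* ℂ where
  toFun M := ψ (PowerSeries.coeff 0 (M.1.1 0 1) + PowerSeries.coeff 1 (M.1.1 1 0))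
  map_one' := by simp
  map_mul' := by
    rintro ⟨M, hM⟩ ⟨N, hN⟩
    obtain ⟨a, b, c, d, h⟩ := (mem_iwahoriZeroGL_iff_exists M).1 hM
    obtain ⟨a', b', c', d', h'⟩ := (mem_iwahoriZeroGL_iff_exists N).1 hN
    rw [← AddChar.map_add_eq_mul]
    congr 1
    have e : PowerSeries.X * c * (1 + PowerSeries.X * a') +
        (1 + PowerSeries.X * d) * (PowerSeries.X * c') =
        PowerSeries.X * (c + c' + PowerSeries.X * (c * a' + d * c')) := by ring
    have h1 : ∀ f : F⟦X⟧, PowerSeries.coeff 1 (PowerSeries.X * f) =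
        PowerSeries.constantCoeff f := fun f => by
      rw [← PowerSeries.coeff_zero_eq_constantCoeff_apply]
      exact PowerSeries.coeff_succ_X_mul 0 f
    simp only [MulMemClass.mk_mul_mk, Units.val_mul, h, h', Matrix.mul_fin_two,
      Matrix.of_apply, Matrix.cons_val', Matrix.cons_val_zero, Matrix.cons_val_one,
      Matrix.cons_val_fin_one, e, h1]
    simp
    ring

theorem affineGenericGL_eq_of_integralToPGL_eq (ψ : AddChar F ℂ) {M N : iwahoriZeroGL F}
    (h : integralToPGL F M = integralToPGL F N) : affineGenericGL ψ M = affineGenericGL ψ N := by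
  have key : ∀ P : iwahoriZeroGL F, integralToPGL F P = 1 → affineGenericGL ψ P = 1 := by
    intro P hP
    rw [integralToPGL, MonoidHom.comp_apply, eq_comm, ← ProjGenLinGroup.mk_one,
      ProjGenLinGroup.mk_eq_mk_iff] at hP
    obtain ⟨u, hu⟩ := hP
    have hu := fun i j => congrArg (fun M : GL (Fin 2) F⸨X⸩ => M.1 i j) hu
    have h01 : P.1.1 0 1 = 0 := by
      have h' := hu 0 1
      simp at h'
      exact HahnSeries.ofPowerSeries_injective (h'.symm.trans (map_zero _).symm)
    have h10 : P.1.1 1 0 = 0 := by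
      have h' := hu 1 0
      simp at h'
      exact HahnSeries.ofPowerSeries_injective (h'.symm.trans (map_zero _).symm)
    simp [affineGenericGL, h01, h10]
  have h1 : affineGenericGL ψ (M * N⁻¹) = 1 := key _ (by simp [h])
  calc affineGenericGL ψ M = affineGenericGL ψ (M * N⁻¹ * N) := by simp
    _ = affineGenericGL ψ N := by rw [map_mul, h1, one_mul]

/-- Conjugation by `σ` preserves the matrices representing `I⁰` and the character. -/
theorem exists_sigma_conj (ψ : AddChar F ℂ) (M : iwahoriZeroGL F) :
    ∃ N : iwahoriZeroGL F, sigma F * integralToPGL F M = integralToPGL F N * sigma F ∧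
      affineGenericGL ψ N = affineGenericGL ψ M := by
  obtain ⟨M, hM⟩ := M
  obtain ⟨a, b, c, d, h⟩ := (mem_iwahoriZeroGL_iff_exists M).1 hM
  have hdet : IsUnit (!![1 + PowerSeries.X * d, c; PowerSeries.X * b, 1 + PowerSeries.X * a] :
      Matrix (Fin 2) (Fin 2) F⟦X⟧).det := by
    rw [PowerSeries.isUnit_iff_constantCoeff]
    simp [Matrix.det_fin_two]
  let N : GL (Fin 2) F⟦X⟧ := GeneralLinearGroup.mk'' _ hdet
  have hNval : N.1 = !![1 + PowerSeries.X * d, c; PowerSeries.X * b, 1 + PowerSeries.X * a] := rfl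
  have hN : N ∈ iwahoriZeroGL F := (mem_iwahoriZeroGL_iff_exists N).2 ⟨d, c, b, a, hNval⟩
  refine ⟨⟨N, hN⟩, ?_, ?_⟩
  · simp only [sigma, integralToPGL, MonoidHom.comp_apply, ← map_mul]
    congr 1
    ext i j
    fin_cases i <;> fin_cases j <;>
      simp [sigmaGL, Matrix.mul_apply, Fin.sum_univ_two, h, hNval, unif, mul_comm]
  · have h1 : ∀ f : F⟦X⟧, PowerSeries.coeff 1 (PowerSeries.X * f) =
        PowerSeries.constantCoeff f := fun f => by
      rw [← PowerSeries.coeff_zero_eq_constantCoeff_apply]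
      exact PowerSeries.coeff_succ_X_mul 0 f
    simp [affineGenericGL, h, hNval, h1, add_comm]

/-- `σ` does not lie in `I⁰`. -/
theorem sigma_ne (M : iwahoriZeroGL F) : integralToPGL F M ≠ sigma F := by
  intro h
  rw [integralToPGL, MonoidHom.comp_apply, sigma, eq_comm, ProjGenLinGroup.mk_eq_mk_iff] at h
  obtain ⟨u, hu⟩ := h
  have h00 := congrArg (fun M : GL (Fin 2) F⸨X⸩ => M.1 0 0) hu
  have h1 := ((mem_iwahoriZeroGL_iff M.1).1 M.2).1
  simp [sigmaGL] at h00
  have h2 : M.1.1 0 0 = 0 :=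
    HahnSeries.ofPowerSeries_injective (h00.symm.trans (map_zero _).symm)
  simp [h2] at h1

theorem mem_inducingGroup {g : PGL(2, F⸨X⸩)} (hg : g ∈ inducingGroup F) :
    ∃ M : iwahoriZeroGL F, g = integralToPGL F M ∨ g = integralToPGL F M * sigma F := by
  have hσ := sigma_mul_self F
  let B : Subgroup PGL(2, F⸨X⸩) :=
    { carrier := {g | ∃ M : iwahoriZeroGL F,
        g = integralToPGL F M ∨ g = integralToPGL F M * sigma F}
      mul_mem' := by
        rintro _ _ ⟨M, rfl | rfl⟩ ⟨N, rfl | rfl⟩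
        · exact ⟨M * N, Or.inl (by simp)⟩
        · exact ⟨M * N, Or.inr (by simp [mul_assoc])⟩
        · obtain ⟨N', h, -⟩ := exists_sigma_conj 1 N
          exact ⟨M * N', Or.inr (by simp [mul_assoc, h])⟩
        · obtain ⟨N', h, -⟩ := exists_sigma_conj 1 N
          refine ⟨M * N', Or.inl ?_⟩
          rw [mul_assoc, ← mul_assoc (sigma F), h, mul_assoc, hσ]
          simp
      one_mem' := ⟨1, Or.inl (by simp)⟩
      inv_mem' := by
        rintro _ ⟨M, rfl | rfl⟩
        · exact ⟨M⁻¹, Or.inl (by simp)⟩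
        · obtain ⟨N', h, -⟩ := exists_sigma_conj 1 M⁻¹
          refine ⟨N', Or.inr ?_⟩
          rw [← h, _root_.mul_inv_rev, inv_eq_of_mul_eq_one_left hσ]
          simp }
  have hB : inducingGroup F ≤ B := by
    refine sup_le ?_ ?_
    · rintro _ ⟨M, hM, rfl⟩
      exact ⟨⟨M, hM⟩, Or.inl rfl⟩
    · rw [Subgroup.zpowers_le]
      exact ⟨1, Or.inr (by simp)⟩
  exact hB hg

/-- The character of `I⁰` extends to a character of `A` with value `1` at `σ`, in exactly
one way. -/
theorem existsUnique_affineGeneric (ψ : AddChar F ℂ) : ∃! χ : inducingGroup F →* ℂ,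
    (∀ M : iwahoriZeroGL F, χ ⟨integralToPGL F M, integralToPGL_mem M.2⟩ = affineGenericGL ψ M) ∧
      χ ⟨sigma F, sigma_mem F⟩ = 1 := by
  have hσ := sigma_mul_self F
  choose m hm using fun g : inducingGroup F => mem_inducingGroup g.2
  have spec : ∀ (g : inducingGroup F) (M : iwahoriZeroGL F),
      (g.1 = integralToPGL F M ∨ g.1 = integralToPGL F M * sigma F) →
      affineGenericGL ψ (m g) = affineGenericGL ψ M := by
    intro g M hM
    have hm := hm g
    rcases hm with h | h <;> rcases hM with h' | h'
    · exact affineGenericGL_eq_of_integralToPGL_eq ψ (h.symm.trans h')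
    · refine absurd ?_ (sigma_ne (M⁻¹ * m g))
      simp [← h, h']
    · refine absurd ?_ (sigma_ne ((m g)⁻¹ * M))
      simp [← h', h]
    · exact affineGenericGL_eq_of_integralToPGL_eq ψ (mul_right_cancel (h.symm.trans h'))
  let χ : inducingGroup F →* ℂ :=
    { toFun := fun g => affineGenericGL ψ (m g)
      map_one' := by
        rw [spec 1 1 (Or.inl (by simp)), map_one]
      map_mul' := by
        intro g g'
        obtain ⟨N, hN, hN'⟩ := exists_sigma_conj ψ (m g')
        rcases hm g with h | h <;> rcases hm g' with h' | h'
        · rw [← map_mul]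
          exact spec _ _ (Or.inl (by simp [← h, ← h']))
        · rw [← map_mul]
          refine spec _ _ (Or.inr ?_)
          rw [Subgroup.coe_mul, Subgroup.coe_mul, map_mul, mul_assoc, ← h', ← h]
        · rw [← hN', ← map_mul]
          refine spec _ _ (Or.inr ?_)
          rw [Subgroup.coe_mul, h, h', Subgroup.coe_mul, map_mul, mul_assoc, hN, mul_assoc]
        · rw [← hN', ← map_mul]
          refine spec _ _ (Or.inl ?_)
          rw [Subgroup.coe_mul, h, h', Subgroup.coe_mul, map_mul, mul_assoc,
            ← mul_assoc (sigma F), hN, mul_assoc, hσ, mul_one] }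
  refine ⟨χ, ⟨fun M => spec _ _ (Or.inl rfl), ?_⟩, ?_⟩
  · change affineGenericGL ψ (m ⟨sigma F, sigma_mem F⟩) = 1
    rw [spec _ 1 (Or.inr (by simp)), map_one]
  · rintro χ' ⟨h1, h2⟩
    ext g
    change χ' g = affineGenericGL ψ (m g)
    rcases hm g with h | h
    · rw [← h1]
      congr 1
      exact Subtype.ext h
    · have : g = ⟨integralToPGL F (m g), integralToPGL_mem (m g).2⟩ *
          ⟨sigma F, sigma_mem F⟩ := Subtype.ext h
      conv_lhs => rw [this]
      rw [map_mul, h1, h2, mul_one]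

/-- The character `χ` of `A` with `χ (1 + ta, b; tc, 1 + td) = ψ(b₀ + c₀)` and `χ(σ) = 1`. -/
noncomputable def affineGeneric (ψ : AddChar F ℂ) : inducingGroup F →* ℂ :=
  (existsUnique_affineGeneric ψ).choose

theorem affineGeneric_integralToPGL (ψ : AddChar F ℂ) (M : iwahoriZeroGL F) :
    affineGeneric ψ ⟨integralToPGL F M, integralToPGL_mem M.2⟩ =
      ψ (PowerSeries.coeff 0 (M.1.1 0 1) + PowerSeries.coeff 1 (M.1.1 1 0)) :=
  (existsUnique_affineGeneric ψ).choose_spec.1.1 M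

theorem affineGeneric_sigma (ψ : AddChar F ℂ) :
    affineGeneric ψ ⟨sigma F, sigma_mem F⟩ = 1 :=
  (existsUnique_affineGeneric ψ).choose_spec.1.2

/-- The representation `V = ind_A^{PGL₂(F((t)))} χ`. -/
noncomputable def simpleSupercuspidal (ψ : AddChar F ℂ) :
    Representation ℂ PGL(2, F⸨X⸩) (compactIndSpace (inducingGroup F) (affineGeneric ψ)) :=
  compactInd (inducingGroup F) (affineGeneric ψ)

end Group

/-!
Over a compact open subgroup `A`, Mackey's criterion makes `ind χ` irreducible as soon as only the
elements of `A` intertwine `χ`; and if every conjugate `g⁻¹Ng` of a subgroup `N` contains a point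
of `A` where `χ` is nontrivial, then `ind χ` has no nonzero `N`-invariant functional. All the
points needed here are conjugates under `A` of `n(x) = (1, x; 0, 1)` with `x` a constant and
`ψ(x) ≠ 1`. The torus element `a(y) = (y, 0; 0, 1)` conjugates `n(x)` into `n(yx)`.

* The Iwasawa decomposition `g = n(u) a(y) α` with `α ∈ A` shows that `g` conjugates `α⁻¹ n(x) α`
  into `U(K)`, whence cuspidality.
* The Cartan decomposition `g = α a(c tⁿ) β` with `n ≥ 0`, `c` a nonzero constant and `α, β ∈ A`
  reduces intertwining to `a(c tⁿ)`, which compares `ψ(x)` with `ψ(c x)` if `n = 0` and with `1` if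
  `n > 0`. So only `a(1)` can intertwine.
* For `n` large `α n(c tⁿ x) α⁻¹` lies in a given open subgroup `U`, uniformly in `α ∈ A`, so a
  `U`-fixed function vanishes on `A a(c tⁿ) A`, and the remaining double cosets have compact union.
-/

section SmoothRepresentations

open Topology

variable {G V : Type*} [Group G] [AddCommGroup V] [Module ℂ V]

/-- The twist `g ↦ χ(g) ρ(g)` of a representation `ρ` by a character `χ`. -/
def charTwist (χ : G →* ℂ) (ρ : Representation ℂ G V) : Representation ℂ G V where
  toFun g := χ g • ρ g
  map_one' := by rw [map_one, map_one, one_smul]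
  map_mul' g h := by rw [map_mul, map_mul, smul_mul_smul_comm]

variable [TopologicalSpace G] {ρ : Representation ℂ G V}

theorem IsSmoothRep.comp_subtype (hρ : IsSmoothRep ρ) (A : Subgroup G) :
    IsSmoothRep (ρ.comp A.subtype) := fun v =>
  let ⟨U, hU, hv⟩ := hρ v
  ⟨U.subgroupOf A, hU.preimage continuous_subtype_val, fun u hu => hv u hu⟩

theorem IsSmoothRep.charTwist (hρ : IsSmoothRep ρ) {χ : G →* ℂ}
    (hχ : IsOpen (χ.ker : Set G)) : IsSmoothRep (charTwist χ ρ) := fun v =>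
  let ⟨U, hU, hv⟩ := hρ v
  ⟨U ⊓ χ.ker, hU.inter hχ, fun u ⟨huU, huχ⟩ => by
    change χ u • ρ u v = v
    rw [hv u huU, MonoidHom.mem_ker.1 huχ, one_smul]⟩

theorem IsSmoothRep.isLocallyConstant [ContinuousMul G] (hρ : IsSmoothRep ρ) (v : V) :
    IsLocallyConstant fun g => ρ g v := by
  obtain ⟨U, hU, hv⟩ := hρ v
  refine IsLocallyConstant.iff_exists_open _ |>.2 fun g =>
    ⟨(g⁻¹ * ·) ⁻¹' U, hU.preimage (by fun_prop), by simp, fun x hx => ?_⟩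
  rw [← mul_inv_cancel_left g x, map_mul, Module.End.mul_apply, hv _ hx]

/-- Averaging over a compact group: the orbit of `v` is finite, and `e` is the mean of its
elements. -/
theorem IsSmoothRep.exists_average [CompactSpace G] [ContinuousMul G] (hρ : IsSmoothRep ρ)
    (v : V) : ∃ e ∈ Submodule.span ℂ (Set.range fun g => ρ g v), (∀ g, ρ g e = e) ∧
      ∀ l : V →ₗ[ℂ] ℂ, (∀ g, l (ρ g v) = l v) → l e = l v := by
  have hfin := (hρ.isLocallyConstant v).range_finite
  let orbit := hfin.toFinset
  have mem_orbit (w : V) : w ∈ orbit ↔ ∃ g, ρ g v = w := by simp [orbit]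
  have hcard : (orbit.card : ℂ) ≠ 0 :=
    Nat.cast_ne_zero.2 (Finset.card_ne_zero_of_mem ((mem_orbit v).2 ⟨1, by simp⟩))
  refine ⟨(orbit.card : ℂ)⁻¹ • ∑ w ∈ orbit, w, ?_, fun g => ?_, fun l hl => ?_⟩
  · exact Submodule.smul_mem _ _ (Submodule.sum_mem _ fun w hw =>
      Submodule.subset_span ((mem_orbit w).1 hw))
  · rw [map_smul, map_sum]
    congr 1
    refine Finset.sum_bijective (ρ g) (ρ.apply_bijective g) (fun w => ?_) fun _ _ => rfl
    rw [mem_orbit, mem_orbit]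
    constructor
    · rintro ⟨h, rfl⟩
      exact ⟨g * h, by simp⟩
    · rintro ⟨h, hw⟩
      exact ⟨g⁻¹ * h, by simp [hw]⟩
  · have hconst : ∀ w ∈ orbit, l w = l v := fun w hw => by
      obtain ⟨g, rfl⟩ := (mem_orbit w).1 hw
      exact hl g
    rw [map_smul, map_sum, Finset.sum_congr rfl hconst, Finset.sum_const, nsmul_eq_mul,
      smul_eq_mul, inv_mul_cancel_left₀ hcard]

end SmoothRepresentations

section CompactInduction

open Topology

variable {G : Type*} [Group G] {A : Subgroup G} {χ : A →* ℂ}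

/-- The function on `G` extending a character of a subgroup by zero; for a compact open subgroup
it generates the compact induction of the character. -/
noncomputable def extendByZero (χ : A →* ℂ) : G → ℂ :=
  Function.extend ((↑) : A → G) χ 0

@[simp]
theorem extendByZero_coe (a : A) : extendByZero χ (a : G) = χ a :=
  Subtype.val_injective.extend_apply _ _ a

theorem extendByZero_of_notMem {g : G} (hg : g ∉ A) : extendByZero χ g = 0 :=
  Function.extend_apply' _ _ g fun ⟨a, ha⟩ => hg (ha ▸ a.2)

theorem extendByZero_mul_coe (g : G) (a : A) :
    extendByZero χ (g * a) = χ a * extendByZero χ g := by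
  by_cases hg : g ∈ A
  · lift g to A using hg
    rw [← Subgroup.coe_mul, extendByZero_coe, extendByZero_coe, map_mul, mul_comm]
  · rw [extendByZero_of_notMem hg, extendByZero_of_notMem fun h => hg ?_, mul_zero]
    exact (A.mul_mem_cancel_right a.2).1 h

theorem extendByZero_coe_mul (a : A) (g : G) :
    extendByZero χ (a * g) = χ a * extendByZero χ g := by
  by_cases hg : g ∈ A
  · lift g to A using hg
    rw [← Subgroup.coe_mul, extendByZero_coe, extendByZero_coe, map_mul]
  · rw [extendByZero_of_notMem hg, extendByZero_of_notMem fun h => hg ?_, mul_zero]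
    exact (A.mul_mem_cancel_left a.2).1 h

/-- `g` intertwines `χ` if `χ` and its conjugate by `g` agree on `A ∩ gAg⁻¹`. -/
def Intertwines (χ : A →* ℂ) (g : G) : Prop :=
  ∀ a b : A, (b : G) * g = g * a → χ b = χ a

theorem map_conj_of_commMonoid {M : Type*} [CommMonoid M] (φ : G →* M) (g h : G) :
    φ (g * h * g⁻¹) = φ h :=
  (isConj_iff_eq.1 (φ.map_isConj (isConj_iff.2 ⟨g, rfl⟩))).symm

theorem Intertwines.of_coe_mul_mul_coe {g : G} {α β : A} (h : Intertwines χ (α * g * β)) :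
    Intertwines χ g := fun a b hab => by
  have hconj : ((α * b * α⁻¹ : A) : G) * (α * g * β) = α * g * β * (β⁻¹ * a * β : A) := by
    simpa [mul_assoc] using congrArg (fun x => (α : G) * x * β) hab
  calc χ b = χ (α * b * α⁻¹) := (map_conj_of_commMonoid χ α b).symm
    _ = χ (β⁻¹ * a * β⁻¹⁻¹) := by rw [inv_inv, h _ _ hconj]
    _ = χ a := map_conj_of_commMonoid χ β⁻¹ a

theorem Intertwines.of_ne_zero {f : G → ℂ} (hl : ∀ (a : A) (g : G), f (a * g) = χ a * f g)
    (hr : ∀ (g : G) (a : A), f (g * a) = χ a * f g) {g : G} (hg : f g ≠ 0) :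
    Intertwines χ g := fun a b hab =>
  mul_right_cancel₀ hg (by rw [← hl, hab, hr])

variable [TopologicalSpace G]

theorem extendByZero_mem_compactIndSpace (hA : IsCompact (A : Set G)) (hA' : IsOpen (A : Set G))
    (hχ : IsOpen (χ.ker : Set A)) : extendByZero χ ∈ compactIndSpace A χ := by
  refine ⟨⟨⟨χ.ker.map A.subtype, hA'.isOpenMap_subtype_val _ hχ, ?_⟩, A, hA, fun g hg => ?_⟩,
    extendByZero_mul_coe⟩
  · rintro g _ ⟨u, hu, rfl⟩
    rw [Subgroup.coe_subtype, extendByZero_mul_coe, hu, one_mul]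
  · by_contra h
    exact hg (extendByZero_of_notMem h)

variable [IsTopologicalGroup G]

@[simp]
theorem compactInd_apply (h : G) (f : compactIndSpace A χ) (g : G) :
    (compactInd A χ h f).1 g = f.1 (h⁻¹ * g) := rfl

theorem isLocallyConstant_of_mem_smoothCompactlySupported {f : G → ℂ}
    (hf : f ∈ smoothCompactlySupported G) : IsLocallyConstant f := by
  obtain ⟨⟨U, hU, hfU⟩, -⟩ := hf
  refine IsLocallyConstant.iff_exists_open _ |>.2 fun g =>
    ⟨(g⁻¹ * ·) ⁻¹' U, hU.preimage (by fun_prop), by simp, fun x hx => ?_⟩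
  rw [← mul_inv_cancel_left g x, hfU _ _ hx]

theorem isSmoothRep_compactInd (A : Subgroup G) (χ : A →* ℂ) : IsSmoothRep (compactInd A χ) := by
  rintro ⟨f, hf⟩
  have hloc := isLocallyConstant_of_mem_smoothCompactlySupported hf.1
  obtain ⟨-, C, hC, hfC⟩ := hf.1
  have fixed_on_C : ∀ᶠ u in 𝓝 (1 : G), ∀ g ∈ C, f (u * g) = f g := by
    refine hC.eventually_forall_of_forall_eventually fun g _ => ?_
    filter_upwards [(hloc.comp_continuous continuous_mul).eventually_eq (1, g),
      (hloc.comp_continuous continuous_snd).eventually_eq (1, g)] with p hp hp'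
    simp_all
  have inv_fixed_on_C := (continuous_inv.tendsto' (1 : G) 1 inv_one).eventually fixed_on_C
  let U : Subgroup G :=
    { carrier := {u | ∀ g, f (u * g) = f g}
      mul_mem' := fun {u u'} hu hu' g => by rw [mul_assoc, hu, hu']
      one_mem' := fun g => by rw [one_mul]
      inv_mem' := fun {u} hu g => by rw [← hu, mul_inv_cancel_left] }
  refine ⟨U, U.isOpen_of_mem_nhds (g := 1) ?_, fun u hu => Subtype.ext (funext (inv_mem hu))⟩
  filter_upwards [fixed_on_C, inv_fixed_on_C] with u hu hu_inv g
  by_cases hg : f g = 0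
  · by_contra hug
    have h := hu_inv _ (hfC (hg ▸ hug))
    rw [inv_mul_cancel_left] at h
    exact hug h.symm
  · exact hu g (hfC hg)

theorem finite_mk_image_of_isCompact (hA : IsOpen (A : Set G)) {C : Set G} (hC : IsCompact C) :
    ((QuotientGroup.mk : G → G ⧸ A) '' C).Finite := by
  have := QuotientGroup.discreteTopology hA
  exact (hC.image QuotientGroup.continuous_mk).finite_of_discrete

theorem span_range_translates (hA : IsCompact (A : Set G)) (hA' : IsOpen (A : Set G))
    (hχ : IsOpen (χ.ker : Set A)) : Submodule.span ℂ (Set.range fun g =>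
      compactInd A χ g ⟨_, extendByZero_mem_compactIndSpace hA hA' hχ⟩) = ⊤ := by
  refine eq_top_iff.2 fun f _ => ?_
  obtain ⟨⟨-, C, hC, hfC⟩, hf⟩ := f.2
  let cosets := (finite_mk_image_of_isCompact hA' hC).toFinset
  have hsum : f = ∑ q ∈ cosets, f.1 q.out •
      compactInd A χ q.out ⟨_, extendByZero_mem_compactIndSpace hA hA' hχ⟩ := by
    ext g
    simp only [Submodule.coe_sum, Submodule.coe_smul, Finset.sum_apply, Pi.smul_apply,
      compactInd_apply, smul_eq_mul]
    obtain ⟨a, ha⟩ := QuotientGroup.mk_out_eq_mul A g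
    rw [Finset.sum_eq_single (g : G ⧸ A)]
    · have h : (g : G ⧸ A).out⁻¹ * g = ((a⁻¹ : A) : G) := by simp [ha]
      rw [h, extendByZero_coe, ha, hf, mul_right_comm, ← map_mul, mul_inv_cancel, map_one, one_mul]
    · intro q _ hq
      rw [extendByZero_of_notMem, mul_zero]
      rwa [← QuotientGroup.eq, QuotientGroup.out_eq']
    · intro hq
      have h0 : f.1 g = 0 := by
        by_contra h
        exact hq ((Set.Finite.mem_toFinset _).2 ⟨g, hfC h, rfl⟩)
      rw [ha, hf, h0, mul_zero, zero_mul]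
  rw [hsum]
  exact Submodule.sum_mem _ fun q _ => Submodule.smul_mem _ _ (Submodule.subset_span ⟨_, rfl⟩)

/-- Averaging the functions `χ(a) • (a · f)` over `a ∈ A`. -/
theorem exists_biequivariant_mem (hA : IsCompact (A : Set G)) (hχ : IsOpen (χ.ker : Set A))
    (W : Subrepresentation (compactInd A χ)) {f : compactIndSpace A χ} (hf : f ∈ W) :
    ∃ e ∈ W, e.1 1 = f.1 1 ∧ ∀ (a : A) (g : G), e.1 (a * g) = χ a * e.1 g := by
  have : CompactSpace A := isCompact_iff_compactSpace.1 hA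
  obtain ⟨e, he, heA, heval⟩ :=
    (((isSmoothRep_compactInd A χ).comp_subtype A).charTwist hχ).exists_average f
  refine ⟨e, Submodule.span_le (p := W.toSubmodule).2 ?_ he, ?_, fun a g => ?_⟩
  · rintro _ ⟨a, rfl⟩
    exact W.toSubmodule.smul_mem _ (W.apply_mem_toSubmodule _ hf)
  · refine heval (LinearMap.proj 1 ∘ₗ (compactIndSpace A χ).subtype) fun a => ?_
    change χ a * f.1 ((a : G)⁻¹ * 1) = f.1 1
    have h := f.2.2 (a : G)⁻¹ a
    rw [mul_one, ← h, inv_mul_cancel]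
  · have h : χ a * e.1 ((a : G)⁻¹ * (a * g)) = e.1 (a * g) :=
      congrArg (fun f : compactIndSpace A χ => f.1 (a * g)) (heA a)
    rw [← h, inv_mul_cancel_left]

theorem extendByZero_mem_of_ne_bot (hA : IsCompact (A : Set G)) (hA' : IsOpen (A : Set G))
    (hχ : IsOpen (χ.ker : Set A)) (h : ∀ g, Intertwines χ g → g ∈ A)
    {W : Subrepresentation (compactInd A χ)} (hW : W ≠ ⊥) :
    ⟨_, extendByZero_mem_compactIndSpace hA hA' hχ⟩ ∈ W := by
  obtain ⟨f, hfW, hf⟩ : ∃ f ∈ W, f ≠ 0 := by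
    by_contra! hn
    exact hW (Subrepresentation.toSubmodule_injective ((Submodule.eq_bot_iff _).2 hn))
  obtain ⟨g, hg⟩ : ∃ g, f.1 g ≠ 0 := by
    by_contra! hn
    exact hf (Subtype.ext (funext hn))
  obtain ⟨e, heW, he1, he⟩ := exists_biequivariant_mem hA hχ W (W.apply_mem_toSubmodule g⁻¹ hfW)
  have he1 : e.1 1 ≠ 0 := by simpa [he1] using hg
  have he_eq : e = e.1 1 • ⟨_, extendByZero_mem_compactIndSpace hA hA' hχ⟩ := by
    ext x
    change e.1 x = e.1 1 * extendByZero χ x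
    by_cases hx : x ∈ A
    · lift x to A using hx
      rw [extendByZero_coe, mul_comm, ← he, mul_one]
    · rw [extendByZero_of_notMem hx, mul_zero]
      by_contra hex
      exact hx (h x (.of_ne_zero he e.2.2 hex))
  exact (W.toSubmodule.smul_mem_iff he1).1 (he_eq ▸ heW)

theorem isIrreducible_compactInd (hA : IsCompact (A : Set G)) (hA' : IsOpen (A : Set G))
    (hχ : IsOpen (χ.ker : Set A)) (h : ∀ g, Intertwines χ g → g ∈ A) :
    (compactInd A χ).IsIrreducible := by
  let f₀ : compactIndSpace A χ := ⟨_, extendByZero_mem_compactIndSpace hA hA' hχ⟩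
  have hf₀ : f₀ ≠ 0 := fun h0 => by
    have h1 : extendByZero χ ((1 : A) : G) = 0 := congrArg (fun f => f.1 ((1 : A) : G)) h0
    rw [extendByZero_coe, map_one] at h1
    exact one_ne_zero h1
  have : Nontrivial (Subrepresentation (compactInd A χ)) := by
    refine ⟨⊥, ⊤, fun h0 => hf₀ ?_⟩
    have hf₀_mem : f₀ ∈ (⊤ : Subrepresentation (compactInd A χ)) := Submodule.mem_top
    rwa [← h0] at hf₀_mem
  refine IsSimpleOrder.mk fun W => or_iff_not_imp_left.2 fun hW =>
    Subrepresentation.toSubmodule_injective (eq_top_iff.2 ?_)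
  refine (span_range_translates hA hA' hχ).ge.trans (Submodule.span_le.2 ?_)
  rintro _ ⟨g, rfl⟩
  exact W.apply_mem_toSubmodule g (extendByZero_mem_of_ne_bot hA hA' hχ h hW)

theorem eq_zero_of_invariant (hA : IsCompact (A : Set G)) (hA' : IsOpen (A : Set G))
    (hχ : IsOpen (χ.ker : Set A)) {N : Subgroup G}
    (h : ∀ g : G, ∃ a : A, g * a * g⁻¹ ∈ N ∧ χ a ≠ 1) {l : compactIndSpace A χ →ₗ[ℂ] ℂ}
    (hl : ∀ n ∈ N, ∀ f, l (compactInd A χ n f) = l f) : l = 0 := by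
  refine LinearMap.ext_on (span_range_translates hA hA' hχ) ?_
  rintro _ ⟨g, rfl⟩
  obtain ⟨a, ha, hχa⟩ := h g
  set f := compactInd A χ g ⟨_, extendByZero_mem_compactIndSpace hA hA' hχ⟩
  have haf : compactInd A χ (g * a * g⁻¹)⁻¹ f = χ a • f := by
    ext x
    change extendByZero χ (g⁻¹ * ((g * a * g⁻¹)⁻¹⁻¹ * x)) = χ a * extendByZero χ (g⁻¹ * x)
    rw [← extendByZero_coe_mul]
    simp [mul_assoc]
  have hlf := hl _ (inv_mem ha) f
  rw [haf, map_smul, smul_eq_mul] at hlf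
  by_contra h0
  exact hχa ((mul_eq_right₀ h0).1 hlf)

theorem eq_zero_of_mem_fixedVectors {U : Subgroup G} {f : compactIndSpace A χ}
    (hf : f ∈ fixedVectors (compactInd A χ) U) {g : G} {a : A} (ha : g * a * g⁻¹ ∈ U)
    (hχa : χ a ≠ 1) : f.1 g = 0 := by
  by_contra hg
  have h := congrArg (fun f' => f'.1 g) (hf _ (inv_mem ha))
  simp only [compactInd_apply, inv_inv, inv_mul_cancel_right] at h
  rw [f.2.2] at h
  exact hχa (mul_eq_right₀ hg |>.1 h)

theorem finiteDimensional_fixedVectors_compactInd (hA' : IsOpen (A : Set G)) {U : Subgroup G}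
    {C : Set G} (hC : IsCompact C) (h : ∀ g ∉ C, ∃ a : A, g * a * g⁻¹ ∈ U ∧ χ a ≠ 1) :
    FiniteDimensional ℂ (fixedVectors (compactInd A χ) U) := by
  let cosets := (QuotientGroup.mk : G → G ⧸ A) '' C
  have : Finite cosets := finite_mk_image_of_isCompact hA' hC
  let restrict : fixedVectors (compactInd A χ) U →ₗ[ℂ] (cosets → ℂ) :=
    (LinearMap.funLeft ℂ ℂ fun q : cosets => q.1.out) ∘ₗ
      (compactIndSpace A χ).subtype ∘ₗ (fixedVectors (compactInd A χ) U).subtype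
  refine FiniteDimensional.of_injective restrict fun f f' hff' => ?_
  ext g
  by_cases hg : g ∈ C
  · obtain ⟨a, ha⟩ := QuotientGroup.mk_out_eq_mul A g
    have h0 : f.1.1 (g : G ⧸ A).out = f'.1.1 (g : G ⧸ A).out :=
      congrFun hff' ⟨g, g, hg, rfl⟩
    rw [ha, f.1.2.2, f'.1.2.2] at h0
    exact mul_left_cancel₀ ((Group.isUnit a).map χ).ne_zero h0
  · obtain ⟨a, ha, hχa⟩ := h g hg
    rw [eq_zero_of_mem_fixedVectors f.2 ha hχa, eq_zero_of_mem_fixedVectors f'.2 ha hχa]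

end CompactInduction

section LaurentSeries

open Topology PowerSeries

variable {F : Type*} [Field F]

theorem coe_X_mul (f : F⟦X⟧) : ((X * f : F⟦X⟧) : F⸨X⸩) = unif F * f := map_mul _ X f

theorem unif_pow_eq_coe (n : ℕ) : unif F ^ n = ((X ^ n : F⟦X⟧) : F⸨X⸩) := by
  simp [unif]

theorem valued_v_le_exp_neg_iff (n : ℕ) (x : F⸨X⸩) :
    Valued.v x ≤ WithZero.exp (-n : ℤ) ↔ ∃ f : F⟦X⟧, ((X ^ n * f : F⟦X⟧) : F⸨X⸩) = x := by
  have hn : unif F ^ n ≠ 0 := pow_ne_zero n (unif_ne_zero F)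
  have hv : Valued.v (unif F ^ n) = WithZero.exp (-n : ℤ) := LaurentSeries.valuation_X_pow F n
  rw [← hv, ← div_le_one₀ (zero_lt_iff.2 ((Valuation.ne_zero_iff _).2 hn)), ← map_div₀,
    LaurentSeries.val_le_one_iff_eq_coe]
  refine exists_congr fun f => ?_
  rw [eq_div_iff hn, map_mul, ← unif_pow_eq_coe, mul_comm]

theorem eq_coe_or_inv_eq_unif_mul_coe (x : F⸨X⸩) :
    (∃ f : F⟦X⟧, x = f) ∨ ∃ f : F⟦X⟧, x⁻¹ = unif F * f := by
  rcases le_or_gt (Valued.v x) 1 with hx | hx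
  · obtain ⟨f, hf⟩ := (LaurentSeries.val_le_one_iff_eq_coe F x).1 hx
    exact .inl ⟨f, hf.symm⟩
  · have hinv : Valued.v x⁻¹ ≤ WithZero.exp (-(1 : ℕ) : ℤ) := by
      rw [← WithZero.lt_mul_exp_iff_le WithZero.exp_ne_zero, ← WithZero.exp_add, map_inv₀]
      simpa using inv_lt_one_of_one_lt₀ hx
    obtain ⟨f, hf⟩ := (valued_v_le_exp_neg_iff 1 _).1 hinv
    exact .inr ⟨f, by rw [← hf, pow_one, coe_X_mul]⟩

theorem hasBasis_nhds_zero_laurentSeries :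
    (𝓝 (0 : F⸨X⸩)).HasBasis (fun _ : ℕ => True)
      fun n => Set.range fun f : F⟦X⟧ => ((X ^ n * f : F⟦X⟧) : F⸨X⸩) := by
  refine ⟨fun s => ⟨fun hs => ?_, fun ⟨n, _, hns⟩ => ?_⟩⟩
  · obtain ⟨γ, hγ⟩ := Valued.mem_nhds.1 hs
    obtain ⟨n, hn⟩ := WithZero.exists_exp_neg_natCast_lt
      (x := MonoidWithZeroHom.ValueGroup₀.embedding γ.1) (by simp)
    refine ⟨n, trivial, fun x hx => hγ ?_⟩
    rw [Set.mem_ofPred_eq, Valuation.restrict_lt_iff_lt_embedding, sub_zero]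
    exact ((valued_v_le_exp_neg_iff n x).2 hx).trans_lt hn
  · have hopen := Valued.isOpen_ball F⸨X⸩ ((Valued.v (R := F⸨X⸩)).restrict (unif F ^ n))
    have hv : Valued.v (unif F ^ n) = WithZero.exp (-n : ℤ) := LaurentSeries.valuation_X_pow F n
    refine Filter.mem_of_superset (hopen.mem_nhds ?_) fun x hx => hns ?_
    · simp [zero_lt_iff, unif_ne_zero]
    · rw [Set.mem_ofPred_eq, Valuation.restrict_lt_iff, hv] at hx
      exact (valued_v_le_exp_neg_iff n x).1 hx.le

open scoped PowerSeries.WithPiTopology in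
theorem continuous_coe_laurentSeries [TopologicalSpace F] [DiscreteTopology F] :
    Continuous (HahnSeries.ofPowerSeries ℤ F) := by
  refine continuous_of_continuousAt_zero _ ?_
  rw [ContinuousAt, map_zero, hasBasis_nhds_zero_laurentSeries.tendsto_right_iff]
  intro n _
  have hcoeff (i : ℕ) : ∀ᶠ f : F⟦X⟧ in 𝓝 0, coeff i f = 0 := by
    have h := (WithPiTopology.continuous_coeff F i).tendsto 0
    rwa [map_zero, nhds_discrete F, Filter.tendsto_pure] at h
  filter_upwards [(Filter.eventually_all_finite (Set.finite_lt_nat n)).2 fun i _ => hcoeff i]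
    with f hf
  obtain ⟨g, rfl⟩ := X_pow_dvd_iff.2 hf
  exact ⟨g, rfl⟩

end LaurentSeries

section ProjectiveLinearGroup

variable {R : Type*} [CommRing R]

/-- The class of `(1, x; 0, 1)` in `PGL₂(R)`. -/
def upperUnipotent (x : R) : PGL(2, R) := ProjGenLinGroup.mk (GeneralLinearGroup.upperRightHom x)

/-- The matrix `(y, 0; 0, 1)`, as a homomorphism in `y`. -/
def diagGL : Rˣ →* GL (Fin 2) R where
  toFun y := ⟨!![(y : R), 0; 0, 1], !![((y⁻¹ : Rˣ) : R), 0; 0, 1], by simp [one_fin_two],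
    by simp [one_fin_two]⟩
  map_one' := by simp [Units.ext_iff, one_fin_two]
  map_mul' y z := by simp [Units.ext_iff]

/-- The class of `(y, 0; 0, 1)` in `PGL₂(R)`. These classes form the diagonal torus. -/
def diagPGL : Rˣ →* PGL(2, R) := ProjGenLinGroup.mk.comp diagGL

theorem mk_eq_mk_of_eq_smul {n : Type*} [Fintype n] [DecidableEq n] {M N : GL n R} (u : Rˣ)
    (h : N.1 = u • M.1) : ProjGenLinGroup.mk M = ProjGenLinGroup.mk N := by
  refine ProjGenLinGroup.mk_eq_mk_iff.2 ⟨u, Units.ext ?_⟩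
  simp [h, Units.smul_def, smul_eq_mul_diagonal]

theorem diagPGL_mul_upperUnipotent (y : Rˣ) (x : R) :
    diagPGL y * upperUnipotent x = upperUnipotent (y * x) * diagPGL y := by
  simp only [diagPGL, upperUnipotent, MonoidHom.comp_apply, ← map_mul]
  congr 1
  ext i j
  fin_cases i <;> fin_cases j <;> simp [diagGL, Matrix.mul_apply]

theorem upperUnipotent_conj_upperUnipotent (x x' : R) :
    upperUnipotent x * upperUnipotent x' * (upperUnipotent x)⁻¹ = upperUnipotent x' := by
  simp only [upperUnipotent, ← map_mul, ← map_inv, ← AddChar.map_add_eq_mul,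
    ← AddChar.map_neg_eq_inv, add_neg_cancel_comm]

theorem continuous_upperUnipotent [TopologicalSpace R] [IsTopologicalRing R] :
    Continuous (upperUnipotent : R → PGL(2, R)) :=
  QuotientGroup.continuous_mk.comp GeneralLinearGroup.continuous_upperRightHom

theorem upperUnipotent_mem_unipotentPGL {K : Type*} [Field K] (x : K) :
    upperUnipotent x ∈ unipotentPGL K :=
  Subgroup.mem_map_of_mem _ ⟨x, rfl⟩

variable {F : Type*} [Field F]

theorem sigma_mul_diagPGL_mul_sigma (y : F⸨X⸩ˣ) :
    sigma F * diagPGL y * sigma F = diagPGL y⁻¹ := by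
  rw [← mul_right_inj (sigma F), ← mul_assoc, ← mul_assoc, sigma_mul_self, one_mul]
  simp only [diagPGL, sigma, MonoidHom.comp_apply, ← map_mul]
  refine (mk_eq_mk_of_eq_smul y ?_).symm
  ext1 i j
  fin_cases i <;> fin_cases j <;>
    simp [diagGL, sigmaGL, Matrix.mul_apply, Units.smul_def, mul_left_comm (y : F⸨X⸩)]

end ProjectiveLinearGroup

section Decompositions

open PowerSeries

variable {F : Type*} [Field F]

theorem exists_eq_mul_unif_mul_coe_or_exists_eq_mul_coe {c d : F⸨X⸩} (h : c ≠ 0 ∨ d ≠ 0) :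
    (d ≠ 0 ∧ ∃ f : F⟦X⟧, c = d * (unif F * f)) ∨ (c ≠ 0 ∧ ∃ f : F⟦X⟧, d = c * f) := by
  rcases eq_or_ne c 0 with rfl | hc
  · exact .inl ⟨by simpa using h, 0, by simp⟩
  rcases eq_or_ne d 0 with rfl | hd
  · exact .inr ⟨hc, 0, by simp⟩
  rcases eq_coe_or_inv_eq_unif_mul_coe (d / c) with ⟨f, hf⟩ | ⟨f, hf⟩
  · exact .inr ⟨hc, f, by rw [← hf, mul_div_cancel₀ _ hc]⟩
  · exact .inl ⟨hd, f, by rw [← hf, inv_div, mul_div_cancel₀ _ hd]⟩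

theorem upperUnipotent_coe_eq (f : F⟦X⟧) :
    upperUnipotent (f : F⸨X⸩) = integralToPGL F (GeneralLinearGroup.upperRightHom f) := by
  rw [upperUnipotent, integralToPGL, MonoidHom.comp_apply]
  congr 1
  ext i j
  fin_cases i <;> fin_cases j <;> simp

theorem upperRightHom_mem_iwahoriZeroGL (f : F⟦X⟧) :
    GeneralLinearGroup.upperRightHom f ∈ iwahoriZeroGL F := by
  simp [mem_iwahoriZeroGL_iff]

theorem upperUnipotent_coe_mem (f : F⟦X⟧) : upperUnipotent (f : F⸨X⸩) ∈ inducingGroup F :=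
  upperUnipotent_coe_eq f ▸ integralToPGL_mem (upperRightHom_mem_iwahoriZeroGL f)

theorem affineGeneric_upperUnipotent (ψ : AddChar F ℂ) (f : F⟦X⟧) :
    affineGeneric ψ ⟨upperUnipotent (f : F⸨X⸩), upperUnipotent_coe_mem f⟩ =
      ψ (constantCoeff f) := by
  simp only [upperUnipotent_coe_eq]
  rw [affineGeneric_integralToPGL ψ ⟨_, upperRightHom_mem_iwahoriZeroGL f⟩]
  simp

theorem diagPGL_mem_inducingGroup {y : F⸨X⸩ˣ} {f : F⟦X⟧} (hy : (y : F⸨X⸩) = f)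
    (hf : constantCoeff f = 1) : diagPGL y ∈ inducingGroup F := by
  obtain ⟨u, rfl⟩ := PowerSeries.isUnit_iff_constantCoeff.2 (hf ▸ isUnit_one)
  have heq : diagPGL y = integralToPGL F (diagGL u) := by
    rw [diagPGL, integralToPGL, MonoidHom.comp_apply, MonoidHom.comp_apply]
    congr 1
    ext i j
    fin_cases i <;> fin_cases j <;> simp [diagGL, hy]
  exact heq ▸ integralToPGL_mem (by simp [mem_iwahoriZeroGL_iff, diagGL, hf])

theorem mk_eq_upperUnipotent_mul_diagPGL_mul (M : GL (Fin 2) F⸨X⸩) {f : F⸨X⸩}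
    (hd : M.1 1 1 ≠ 0) (hc : M.1 1 0 = M.1 1 1 * (unif F * f)) :
    ProjGenLinGroup.mk M = upperUnipotent (M.1 0 1 / M.1 1 1) *
      diagPGL (M.det * (Units.mk0 _ hd)⁻¹ ^ 2) *
        (sigma F * upperUnipotent f * sigma F) := by
  have ht := unif_ne_zero F
  simp only [upperUnipotent, diagPGL, sigma, MonoidHom.comp_apply, ← map_mul]
  refine (mk_eq_mk_of_eq_smul ((Units.mk0 _ ht)⁻¹ * Units.mk0 _ hd) ?_).symm
  ext1 i j
  fin_cases i <;> fin_cases j <;>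
    simp [diagGL, sigmaGL, Matrix.det_fin_two, Units.smul_def, hc] <;>
    field_simp
  simp

theorem exists_eq_upperUnipotent_mul_diagPGL_mul (g : PGL(2, F⸨X⸩)) :
    ∃ (x : F⸨X⸩) (y : F⸨X⸩ˣ) (α : inducingGroup F), g = upperUnipotent x * diagPGL y * α := by
  have of_lower_row (M : GL (Fin 2) F⸨X⸩) (f : F⟦X⟧) (hd : M.1 1 1 ≠ 0)
      (hc : M.1 1 0 = M.1 1 1 * (unif F * f)) : ∃ (x : F⸨X⸩) (y : F⸨X⸩ˣ)
        (α : inducingGroup F), ProjGenLinGroup.mk M = upperUnipotent x * diagPGL y * α :=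
    ⟨_, _, ⟨_, mul_mem (mul_mem (sigma_mem F) (upperUnipotent_coe_mem f)) (sigma_mem F)⟩,
      mk_eq_upperUnipotent_mul_diagPGL_mul M hd hc⟩
  obtain ⟨M, rfl⟩ := ProjGenLinGroup.mk_surjective g
  have hrow : M.1 1 0 ≠ 0 ∨ M.1 1 1 ≠ 0 := by
    by_contra! h
    exact M.det_ne_zero (by simp [Matrix.det_fin_two, h])
  rcases exists_eq_mul_unif_mul_coe_or_exists_eq_mul_coe hrow with ⟨hd, f, hc⟩ | ⟨hc, f, hd⟩
  · exact of_lower_row M f hd hc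
  · obtain ⟨x, y, α, h⟩ := of_lower_row (M * sigmaGL F) f
      (by simpa [sigmaGL, Matrix.mul_apply] using hc)
      (by simp [sigmaGL, Matrix.mul_apply, hd, mul_assoc, mul_comm (unif F)])
    refine ⟨x, y, α * ⟨sigma F, sigma_mem F⟩, ?_⟩
    rw [Subgroup.coe_mul, ← mul_assoc, ← h, map_mul, ← sigma, mul_assoc, sigma_mul_self, mul_one]

/-- The entry `x` of `(y, x; 0, 1)` serves as pivot: multiplying by the lower triangular matrices
`(1, 0; t f, 1) = σ (1, f; 0, 1) σ` on the left and on the right clears its row and column. -/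
theorem upperUnipotent_mul_diagPGL_eq (x y : F⸨X⸩ˣ) {f f' : F⸨X⸩}
    (hf : (x : F⸨X⸩)⁻¹ = unif F * f) (hf' : (y : F⸨X⸩) / x = unif F * f') :
    upperUnipotent (x : F⸨X⸩) * diagPGL y =
      sigma F * upperUnipotent f * sigma F *
        diagPGL (-(Units.mk0 _ (unif_ne_zero F) * x ^ 2 * y⁻¹)) * upperUnipotent f' * sigma F := by
  have ht := unif_ne_zero F
  have hx := x.ne_zero
  have hy := y.ne_zero
  obtain rfl : f = (unif F * x)⁻¹ := by rw [mul_inv, hf, inv_mul_cancel_left₀ ht]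
  obtain rfl : f' = y / (unif F * x) := by
    rw [mul_comm, ← div_div, hf', mul_div_cancel_left₀ _ ht]
  simp only [upperUnipotent, diagPGL, sigma, MonoidHom.comp_apply, ← map_mul]
  refine mk_eq_mk_of_eq_smul (-(Units.mk0 _ ht ^ 2 * x * y⁻¹)) ?_
  ext1 i j
  fin_cases i <;> fin_cases j <;>
    simp [diagGL, sigmaGL, Matrix.mul_apply, Units.smul_def] <;>
    field_simp
  simp

theorem exists_eq_mul_diagPGL_mul (g : PGL(2, F⸨X⸩)) :
    ∃ (y : F⸨X⸩ˣ) (α β : inducingGroup F), g = α * diagPGL y * β := by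
  obtain ⟨x, y, γ, rfl⟩ := exists_eq_upperUnipotent_mul_diagPGL_mul g
  suffices h : ∃ (z : F⸨X⸩ˣ) (α β : inducingGroup F),
      upperUnipotent x * diagPGL y = α * diagPGL z * β by
    obtain ⟨z, α, β, h⟩ := h
    exact ⟨z, α, β * γ, by rw [h, Subgroup.coe_mul, mul_assoc]⟩
  rcases eq_coe_or_inv_eq_unif_mul_coe x with ⟨f, rfl⟩ | ⟨f, hf⟩
  · exact ⟨y, ⟨_, upperUnipotent_coe_mem f⟩, 1, by simp⟩
  rcases eq_coe_or_inv_eq_unif_mul_coe ((y : F⸨X⸩)⁻¹ * x) with ⟨f', hf'⟩ | ⟨f', hf'⟩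
  · refine ⟨y, 1, ⟨_, upperUnipotent_coe_mem f'⟩, ?_⟩
    simp only [Subgroup.coe_one, one_mul, ← hf', diagPGL_mul_upperUnipotent,
      mul_inv_cancel_left₀ y.ne_zero]
  · rcases eq_or_ne x 0 with rfl | hx
    · exact ⟨y, ⟨_, upperUnipotent_coe_mem 0⟩, 1, by simp⟩
    refine ⟨_, ⟨_, mul_mem (mul_mem (sigma_mem F) (upperUnipotent_coe_mem f)) (sigma_mem F)⟩,
      ⟨_, mul_mem (upperUnipotent_coe_mem f') (sigma_mem F)⟩,
      (upperUnipotent_mul_diagPGL_eq (Units.mk0 x hx) y hf ?_).trans (mul_assoc _ _ _)⟩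
    rw [Units.val_mk0, ← hf', mul_inv, inv_inv, div_eq_mul_inv]

/-- The element `c tⁿ` of `F((t))ˣ`. -/
noncomputable def monomialUnit (n : ℕ) (c : Fˣ) : F⸨X⸩ˣ :=
  Units.mk0 ((X ^ n * C (c : F) : F⟦X⟧) : F⸨X⸩) (by simp)

theorem exists_eq_monomialUnit_mul {y : F⸨X⸩ˣ} {f : F⟦X⟧} (hy : (y : F⸨X⸩) = f) :
    ∃ (n : ℕ) (c : Fˣ) (z : F⸨X⸩ˣ) (f₁ : F⟦X⟧), y = monomialUnit n c * z ∧
      (z : F⸨X⸩) = f₁ ∧ constantCoeff f₁ = 1 := by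
  have hf : f ≠ 0 := by
    rintro rfl
    exact y.ne_zero (hy.trans (map_zero _))
  have hc : constantCoeff (divXPowOrder f) ≠ 0 :=
    constantCoeff_divXPowOrder_eq_zero_iff.not.2 hf
  let c := Units.mk0 _ hc
  let f₁ := C (↑c⁻¹ : F) * divXPowOrder f
  have hval : (y : F⸨X⸩) = monomialUnit f.order.toNat c * (f₁ : F⸨X⸩) := by
    rw [monomialUnit, Units.val_mk0, ← map_mul, mul_assoc, ← mul_assoc (C _), ← map_mul C,
      Units.mul_inv, map_one, one_mul, X_pow_order_mul_divXPowOrder, hy]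
  refine ⟨f.order.toNat, c, (monomialUnit f.order.toNat c)⁻¹ * y, f₁, by simp, ?_, ?_⟩
  · rw [Units.val_mul, hval, Units.inv_mul_cancel_left]
  · simp [f₁, c, hc]

theorem exists_eq_mul_diagPGL_monomialUnit_mul (g : PGL(2, F⸨X⸩)) :
    ∃ (n : ℕ) (c : Fˣ) (α β : inducingGroup F), g = α * diagPGL (monomialUnit n c) * β := by
  obtain ⟨y, α, β, rfl⟩ := exists_eq_mul_diagPGL_mul g
  have of_integral (y : F⸨X⸩ˣ) (f : F⟦X⟧) (hy : (y : F⸨X⸩) = f) :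
      ∃ (n : ℕ) (c : Fˣ) (γ : inducingGroup F), diagPGL y = diagPGL (monomialUnit n c) * γ := by
    obtain ⟨n, c, z, f₁, rfl, hz, hf₁⟩ := exists_eq_monomialUnit_mul hy
    exact ⟨n, c, ⟨_, diagPGL_mem_inducingGroup hz hf₁⟩, map_mul _ _ _⟩
  rcases eq_coe_or_inv_eq_unif_mul_coe (y : F⸨X⸩) with ⟨f, hf⟩ | ⟨f, hf⟩
  · obtain ⟨n, c, γ, h⟩ := of_integral y f hf
    exact ⟨n, c, α, γ * β, by simp only [h, Subgroup.coe_mul, mul_assoc]⟩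
  · obtain ⟨n, c, γ, h⟩ := of_integral y⁻¹ (X * f) (by rw [Units.val_inv_eq_inv_val, hf, coe_X_mul])
    refine ⟨n, c, α * ⟨sigma F, sigma_mem F⟩, γ * ⟨sigma F, sigma_mem F⟩ * β, ?_⟩
    rw [← inv_inv y, ← sigma_mul_diagPGL_mul_sigma, h]
    simp only [Subgroup.coe_mul, mul_assoc]

end Decompositions

section Topology

open Topology PowerSeries

variable {F : Type*} [Field F]

theorem eventually_exists_map_eq_of_X_pow_dvd {n : Type*} [Fintype n] [DecidableEq n]
    (k : ℕ) : ∀ᶠ M : GL n F⸨X⸩ in 𝓝 1, ∃ N : GL n F⟦X⟧,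
      GeneralLinearGroup.map (algebraMap F⟦X⟧ F⸨X⸩) N = M ∧
        ∀ i j, X ^ (k + 1) ∣ (N.1 - 1) i j := by
  have hentry (i j : n) : ∀ᶠ M : GL n F⸨X⸩ in 𝓝 1,
      M.1 i j - (1 : Matrix n n F⸨X⸩) i j ∈
        Set.range fun f : F⟦X⟧ => ((X ^ (k + 1) * f : F⟦X⟧) : F⸨X⸩) := by
    have hcont : Continuous fun M : GL n F⸨X⸩ => M.1 i j - (1 : Matrix n n F⸨X⸩) i j := by
      fun_prop
    refine hcont.continuousAt.eventually_mem ?_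
    simpa using (hasBasis_nhds_zero_laurentSeries (F := F)).mem_of_mem (i := k + 1) trivial
  filter_upwards [Filter.eventually_all.2 fun i => Filter.eventually_all.2 fun j => hentry i j]
    with M hM
  choose P hP using hM
  let N : Matrix n n F⟦X⟧ := 1 + (X ^ (k + 1) : F⟦X⟧) • Matrix.of P
  have hdet : IsUnit N.det := by
    have hN : constantCoeff.mapMatrix N = 1 := by ext i j; simp [N, Matrix.one_apply]
    rw [isUnit_iff_constantCoeff, RingHom.map_det, hN, det_one]
    exact isUnit_one
  refine ⟨GeneralLinearGroup.mk'' N hdet, ?_, fun i j => ⟨P i j, by simp [N]⟩⟩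
  refine Units.ext (Matrix.ext fun i j => ?_)
  have hone : ((1 : Matrix n n F⟦X⟧) i j : F⸨X⸩) = (1 : Matrix n n F⸨X⸩) i j := by
    simp [one_apply, apply_ite]
  change (((1 : Matrix n n F⟦X⟧) i j + X ^ (k + 1) * P i j : F⟦X⟧) : F⸨X⸩) = M.1 i j
  rw [map_add, hone]
  exact add_eq_of_eq_sub' (hP i j)

theorem eventually_affineGeneric_eq_one (ψ : AddChar F ℂ) :
    ∀ᶠ g : PGL(2, F⸨X⸩) in 𝓝 1,
      ∃ hg : g ∈ inducingGroup F, affineGeneric ψ ⟨g, hg⟩ = 1 := by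
  have hnhds : 𝓝 (1 : PGL(2, F⸨X⸩)) = Filter.map ProjGenLinGroup.mk (𝓝 1) :=
    QuotientGroup.nhds_eq _ 1
  rw [hnhds, Filter.eventually_map]
  filter_upwards [eventually_exists_map_eq_of_X_pow_dvd 1] with M ⟨N, hNM, hN⟩
  have hcoeff (i j : Fin 2) {k : ℕ} (hk : k < 2) : coeff k ((N.1 - 1) i j) = 0 :=
    X_pow_dvd_iff.1 (hN i j) k hk
  have hmem : N ∈ iwahoriZeroGL F := by
    rw [mem_iwahoriZeroGL_iff]
    simp_rw [← sub_eq_zero (b := (1 : F))]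
    exact ⟨by simpa using hcoeff 0 0 zero_lt_two, by simpa using hcoeff 1 0 zero_lt_two,
      by simpa using hcoeff 1 1 zero_lt_two⟩
  have h01 : coeff 0 (N.1 0 1) = 0 := by simpa using hcoeff 0 1 zero_lt_two
  have h10 : coeff 1 (N.1 1 0) = 0 := by simpa using hcoeff 1 0 one_lt_two
  subst hNM
  refine ⟨integralToPGL_mem hmem, (affineGeneric_integralToPGL ψ ⟨N, hmem⟩).trans ?_⟩
  rw [h01, h10, add_zero, AddChar.map_zero_eq_one]

theorem isOpen_inducingGroup : IsOpen (inducingGroup F : Set PGL(2, F⸨X⸩)) :=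
  Subgroup.isOpen_of_mem_nhds _ ((eventually_affineGeneric_eq_one 1).mono fun _ hg => hg.1)

theorem isOpen_ker_affineGeneric (ψ : AddChar F ℂ) :
    IsOpen ((affineGeneric ψ).ker : Set (inducingGroup F)) := by
  refine Subgroup.isOpen_of_mem_nhds _ (g := 1) ?_
  have h := (continuous_subtype_val.tendsto (1 : inducingGroup F)).eventually
    (eventually_affineGeneric_eq_one ψ)
  exact h.mono fun _ ⟨_, hα⟩ => hα

open scoped PowerSeries.WithPiTopology in
theorem isCompact_range_integralToPGL [Finite F] :
    IsCompact (Set.range (integralToPGL F)) := by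
  let : TopologicalSpace F := ⊥
  have : DiscreteTopology F := ⟨rfl⟩
  have : CompactSpace F⟦X⟧ := inferInstanceAs (CompactSpace ((Unit →₀ ℕ) → F))
  have : CompactSpace (Matrix (Fin 2) (Fin 2) F⟦X⟧) :=
    inferInstanceAs (CompactSpace (Fin 2 → Fin 2 → F⟦X⟧))
  have hcont : Continuous (integralToPGL F) :=
    QuotientGroup.continuous_mk.comp continuous_coe_laurentSeries.generalLinearGroup_map
  exact isCompact_range hcont

theorem isCompact_inducingGroup [Finite F] :
    IsCompact (inducingGroup F : Set PGL(2, F⸨X⸩)) := by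
  have hK := isCompact_range_integralToPGL (F := F)
  refine (hK.union (hK.image (continuous_mul_const (sigma F)))).of_isClosed_subset
    (Subgroup.isClosed_of_isOpen _ isOpen_inducingGroup) fun g hg => ?_
  rcases mem_inducingGroup hg with ⟨M, rfl | rfl⟩
  · exact .inl (Set.mem_range_self _)
  · exact .inr (Set.mem_image_of_mem _ (Set.mem_range_self _))

theorem eventually_conj_mem_of_isCompact {G : Type*} [Group G] [TopologicalSpace G]
    [IsTopologicalGroup G] {K U : Set G} (hK : IsCompact K) (hU : U ∈ 𝓝 1) :
    ∀ᶠ g in 𝓝 1, ∀ k ∈ K, k * g * k⁻¹ ∈ U := by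
  refine hK.eventually_forall_of_forall_eventually fun k _ => ?_
  have hcont : Continuous fun p : G × G => p.2 * p.1 * p.2⁻¹ := by fun_prop
  exact (hcont.tendsto' (1, k) 1 (by simp)).eventually_mem hU

theorem exists_conj_upperUnipotent_mem [Finite F] {U : Set PGL(2, F⸨X⸩)} (hU : U ∈ 𝓝 1) :
    ∃ N : ℕ, ∀ (α : inducingGroup F) (f : F⟦X⟧),
      (α * upperUnipotent ((X ^ N * f : F⟦X⟧) : F⸨X⸩) * α⁻¹ : PGL(2, F⸨X⸩)) ∈ U := by
  have h := (continuous_upperUnipotent.tendsto' (0 : F⸨X⸩) 1 (by simp [upperUnipotent])).eventually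
    (eventually_conj_mem_of_isCompact isCompact_inducingGroup hU)
  obtain ⟨N, -, hN⟩ := hasBasis_nhds_zero_laurentSeries.mem_iff.1 h
  exact ⟨N, fun α f => hN ⟨f, rfl⟩ α α.2⟩

theorem isCompact_setOf_eq_mul_diagPGL_monomialUnit_mul [Finite F] (N : ℕ) :
    IsCompact {g : PGL(2, F⸨X⸩) | ∃ n < N, ∃ (c : Fˣ) (α β : inducingGroup F),
      g = α * diagPGL (monomialUnit n c) * β} := by
  have : CompactSpace (inducingGroup F) := isCompact_iff_compactSpace.1 isCompact_inducingGroup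
  have h (n : ℕ) (c : Fˣ) : IsCompact (Set.range fun p : inducingGroup F × inducingGroup F =>
      (p.1 * diagPGL (monomialUnit n c) * p.2 : PGL(2, F⸨X⸩))) :=
    isCompact_range (by fun_prop)
  convert (Set.finite_lt_nat N).isCompact_biUnion fun n _ => isCompact_iUnion (h n) using 1
  ext g
  simp [eq_comm]

end Topology

section SimpleSupercuspidal

open Topology PowerSeries

variable {F : Type*} [Field F] {ψ : AddChar F ℂ}

theorem exists_conj_eq_upperUnipotent (hψ : ψ ≠ 1) (y : F⸨X⸩ˣ) (α : inducingGroup F) :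
    ∃ (x : F) (a : inducingGroup F), affineGeneric ψ a ≠ 1 ∧
      diagPGL y * α * a * (diagPGL y * α)⁻¹ = upperUnipotent (y * ((C x : F⟦X⟧) : F⸨X⸩)) := by
  obtain ⟨x, hx⟩ := AddChar.ne_one_iff.1 hψ
  let ν : inducingGroup F := ⟨_, upperUnipotent_coe_mem (C x)⟩
  refine ⟨x, α⁻¹ * ν * α⁻¹⁻¹, ?_, ?_⟩
  · rwa [map_conj_of_commMonoid, affineGeneric_upperUnipotent, constantCoeff_C]
  · rw [← mul_inv_eq_iff_eq_mul.2 (diagPGL_mul_upperUnipotent y _)]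
    simp [ν, mul_assoc]

theorem isQuasiCuspidal_simpleSupercuspidal [Finite F] (hψ : ψ ≠ 1) :
    IsQuasiCuspidal (simpleSupercuspidal ψ) := fun l hl => by
  refine eq_zero_of_invariant isCompact_inducingGroup isOpen_inducingGroup
    (isOpen_ker_affineGeneric ψ) (fun g => ?_) hl
  obtain ⟨u, y, α, rfl⟩ := exists_eq_upperUnipotent_mul_diagPGL_mul g
  obtain ⟨x, a, ha, hconj⟩ := exists_conj_eq_upperUnipotent hψ y α
  have hmem : upperUnipotent u * (diagPGL y * α * a * (diagPGL y * α)⁻¹) *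
      (upperUnipotent u)⁻¹ ∈ unipotentPGL F⸨X⸩ := by
    rw [hconj, upperUnipotent_conj_upperUnipotent]
    exact upperUnipotent_mem_unipotentPGL _
  exact ⟨a, by simpa [mul_assoc] using hmem, ha⟩

theorem diagPGL_mem_of_intertwines (hψ : ψ ≠ 1) {y : F⸨X⸩ˣ} {f : F⟦X⟧} (hy : (y : F⸨X⸩) = f)
    (h : Intertwines (affineGeneric ψ) (diagPGL y)) : diagPGL y ∈ inducingGroup F := by
  refine diagPGL_mem_inducingGroup hy
    (AddChar.to_mulShift_inj_of_isPrimitive (.of_ne_one hψ) (DFunLike.ext _ _ fun x => ?_))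
  have hx := h ⟨_, upperUnipotent_coe_mem (C x)⟩ ⟨_, upperUnipotent_coe_mem (f * C x)⟩
    (by simp only [diagPGL_mul_upperUnipotent, hy, map_mul])
  rw [affineGeneric_upperUnipotent, affineGeneric_upperUnipotent, map_mul, constantCoeff_C] at hx
  rw [AddChar.mulShift_apply, AddChar.mulShift_apply, hx, one_mul]

theorem mem_inducingGroup_of_intertwines (hψ : ψ ≠ 1) {g : PGL(2, F⸨X⸩)}
    (h : Intertwines (affineGeneric ψ) g) : g ∈ inducingGroup F := by
  obtain ⟨n, c, α, β, rfl⟩ := exists_eq_mul_diagPGL_monomialUnit_mul g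
  exact mul_mem (mul_mem α.2 (diagPGL_mem_of_intertwines hψ rfl h.of_coe_mul_mul_coe)) β.2

theorem isIrreducible_simpleSupercuspidal [Finite F] (hψ : ψ ≠ 1) :
    (simpleSupercuspidal ψ).IsIrreducible :=
  isIrreducible_compactInd isCompact_inducingGroup isOpen_inducingGroup
    (isOpen_ker_affineGeneric ψ) fun _ => mem_inducingGroup_of_intertwines hψ

theorem finiteDimensional_fixedVectors_simpleSupercuspidal [Finite F] (hψ : ψ ≠ 1)
    {U : Subgroup PGL(2, F⸨X⸩)} (hU : IsOpen (U : Set PGL(2, F⸨X⸩))) :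
    FiniteDimensional ℂ (fixedVectors (simpleSupercuspidal ψ) U) := by
  obtain ⟨N, hN⟩ := exists_conj_upperUnipotent_mem (hU.mem_nhds U.one_mem)
  refine finiteDimensional_fixedVectors_compactInd isOpen_inducingGroup
    (isCompact_setOf_eq_mul_diagPGL_monomialUnit_mul N) fun g hg => ?_
  obtain ⟨n, c, α, β, rfl⟩ := exists_eq_mul_diagPGL_monomialUnit_mul g
  obtain ⟨x, a, ha, hconj⟩ := exists_conj_eq_upperUnipotent hψ (monomialUnit n c) β
  have hn : N ≤ n := le_of_not_gt fun hn => hg ⟨n, hn, c, α, β, rfl⟩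
  have hval : (monomialUnit n c : F⸨X⸩) * ((C x : F⟦X⟧) : F⸨X⸩) =
      ((X ^ N * (X ^ (n - N) * C (c : F) * C x) : F⟦X⟧) : F⸨X⸩) := by
    rw [monomialUnit, Units.val_mk0, ← map_mul, ← mul_assoc, ← mul_assoc, ← pow_add,
      Nat.add_sub_cancel' hn]
  refine ⟨a, ?_, ha⟩
  have hmem := hN α (X ^ (n - N) * C (c : F) * C x)
  rw [← hval, ← hconj] at hmem
  simpa [mul_assoc] using hmem

theorem isAdmissibleRep_simpleSupercuspidal [Finite F] (hψ : ψ ≠ 1) :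
    IsAdmissibleRep (simpleSupercuspidal ψ) :=
  ⟨isSmoothRep_compactInd _ _, fun _ => finiteDimensional_fixedVectors_simpleSupercuspidal hψ⟩

end SimpleSupercuspidal

theorem mainTheorem5 {F : Type*} [Field F] [Finite F] (ψ : AddChar F ℂ) (hψ : ψ ≠ 1) :
    (simpleSupercuspidal ψ).IsIrreducible ∧ IsCuspidalRep (simpleSupercuspidal ψ) := by
  exact ⟨isIrreducible_simpleSupercuspidal hψ,
    isAdmissibleRep_simpleSupercuspidal hψ, isQuasiCuspidal_simpleSupercuspidal hψ⟩
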